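/- **Theorem.** Let $\Sigma$ be a finite alphabet and let $A \subseteq \Sigma^{\mathbb{Z}}$ be a minimal subshift, that is, a non-empty closed shift-invariant set containing no proper non-empty closed shift-invariant subset. Suppose that every point of $A$ is strictly quasiperiodic: it is not fixed by the shift by any $n \ge 1$, and for every finite pattern occurring in it there is an $N$ such that the pattern occurs inside every interval of length $N$ of it. Let $x \in A$. Then for every Turing degree $d$ (of an element of $\{0,1\}^{\mathbb{N}}$) with $\deg_T x \le d$ there exists a point $y \in A$ with $\deg_T y = d$. Here the Turing degree of a configuration in $\Sigma^{\mathbb{Z}}$ is that of the function $\mathbb{N} \to \mathbb{N}$ obtained from it by numbering the letters injectively by natural numbers and enumerating $\mathbb{Z}$ as $0,-1,1,-2,2,\dots$; it does not depend on the numbering of the finite alphabet. -/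

import Mathlib

open SymbolicDynamics.FullShift

namespace OneDimSubshift

/-- A pattern is a function `p : P → S` on a finite set `P ⊆ ℤ`.  It occurs at position `z` in the
configuration `x` when `x (z + i) = p i` for all `i ∈ P`. -/
def OccursAt {S : Type*} {P : Finset ℤ} (p : P → S) (x : ℤ → S) (z : ℤ) : Prop :=
  ∀ i : P, x (z + (i : ℤ)) = p i

/-- `x` is periodic: it is fixed by the shift by some positive integer `n`. -/
def IsPeriodicConfig {S : Type*} (x : ℤ → S) : Prop :=
  ∃ n : ℕ, 0 < n ∧ shift (n : ℤ) x = x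

/-- `x` is quasiperiodic: for every pattern occurring in `x` there is `N` such that the pattern
occurs inside every interval `{a, …, a + N - 1}` of length `N` of `x`. -/
def IsQuasiperiodic {S : Type*} (x : ℤ → S) : Prop :=
  ∀ (P : Finset ℤ) (p : P → S), (∃ z : ℤ, OccursAt p x z) →
    ∃ N : ℕ, ∀ a : ℤ, ∃ z : ℤ, OccursAt p x z ∧ ∀ i ∈ P, z + i ∈ Set.Ico a (a + N)

/-- Quasiperiodic and not periodic. -/
def IsStrictlyQuasiperiodic {S : Type*} (x : ℤ → S) : Prop :=
  IsQuasiperiodic x ∧ ¬ IsPeriodicConfig x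

/-- A subshift is minimal if it is non-empty and contains no proper non-empty subshift. -/
def IsMinimalSubshift {S : Type*} [TopologicalSpace S] (A : Subshift S ℤ) : Prop :=
  A.carrier.Nonempty ∧
    ∀ B : Subshift S ℤ, B.carrier.Nonempty → B.carrier ⊆ A.carrier → B.carrier = A.carrier

/-- The Turing degree of a total function `ℕ → ℕ`. -/
def degree (f : ℕ → ℕ) : TuringDegree :=
  toAntisymmetrization TuringReducible (fun n => Part.some (f n))

/-- The degree `d` is the degree of an element of `{0,1}^ℕ`.  Mathlib's `TuringDegree` also has
degrees of partial functions; the classical Turing degrees are those singled out here. -/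
def IsClassicalDegree (d : TuringDegree) : Prop :=
  ∃ s : ℕ → Bool, degree (fun n => (s n).toNat) = d

/-- The Turing degree of a configuration, where `ν` numbers the letters of the alphabet and
positions are enumerated as `0, -1, 1, -2, 2, …`. For a finite alphabet the degree does
not depend on `ν`. -/
def configDegree {S : Type*} (ν : S ↪ ℕ) (x : ℤ → S) : TuringDegree :=
  degree (fun n => ν (x (Equiv.intEquivNat.symm n)))

end OneDimSubshift

/-! The point `y` is a limit of shifts of `x`, centred at positions chosen to record a sequence `s`
of degree `d`. A window around a position returns to the right, and by aperiodicity the right halves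
at the position and at the first return differ somewhere; the direction of the first difference is
one bit. Both bits are available at copies of any window (`exists_codedBit_eq`): otherwise the right
halves at successive copies would be strictly monotone, while recurrence brings back an arbitrarily
long stretch of an earlier one.

Each step moves to a copy of the current window carrying the next bit of `s`, then enlarges the
window until it determines that bit. The nested windows define `y`, which is computable from `x` and
`s`, hence from `s`. Conversely `y` alone determines the successive radii (`nextRadius_codedConfig`)
and the bits (`codedBit_codedConfig`), so it computes `s`. -/

namespace ComputableIn

/-! ### Closure properties of relative computability. -/

variable {α β γ σ : Type*} [Primcodable α] [Primcodable β] [Primcodable γ] [Primcodable σ]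
  {O : Set (ℕ →. ℕ)}

theorem comp {f : β → σ} {g : α → β} (hf : ComputableIn O f) (hg : ComputableIn O g) :
    ComputableIn O fun a => f (g a) :=
  (Nat.RecursiveIn.comp hf hg).of_eq fun n => by
    rcases e : Encodable.decode (α := α) n with - | a <;> simp [Encodable.encodek]

theorem pair {f : α → β} {g : α → γ} (hf : ComputableIn O f) (hg : ComputableIn O g) :
    ComputableIn O fun a => (f a, g a) :=
  (Nat.RecursiveIn.pair hf hg).of_eq fun n => by
    rcases e : Encodable.decode (α := α) n with - | a <;> simp [Seq.seq]

theorem comp₂ {f : β → γ → σ} {g : α → β} {h : α → γ}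
    (hf : ComputableIn O fun p : β × γ => f p.1 p.2)
    (hg : ComputableIn O g) (hh : ComputableIn O h) : ComputableIn O fun a => f (g a) (h a) :=
  comp (f := fun p : β × γ => f p.1 p.2) hf (hg.pair hh)

theorem nat_rec {f : α → ℕ} {g : α → σ} {h : α → ℕ → σ → σ} (hf : ComputableIn O f)
    (hg : ComputableIn O g) (hh : ComputableIn O fun p : α × ℕ × σ => h p.1 p.2.1 p.2.2) :
    ComputableIn O fun a => Nat.rec (motive := fun _ => σ) (g a) (fun y IH => h a y IH) (f a) := by
  have hid : Nat.RecursiveIn O (fun n => Part.some n) :=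
    Nat.Partrec.some.recursiveIn
  refine ((Nat.RecursiveIn.prec hg hh).comp (hid.pair hf)).of_eq fun n => ?_
  rcases e : Encodable.decode (α := α) n with - | a
  · simp [Seq.seq]
  · simp only [Part.coe_some, Part.bind_some, Seq.seq, e, Part.map_some, Part.map_eq_map,
      Part.bind_eq_bind, Nat.unpair_pair]
    simp only [Encodable.encode_nat, Encodable.decode_prod_val, Nat.unpair_pair, e,
      Encodable.decode_nat]
    induction f a with
    | zero => simp
    | succ m ih => simp only [ih]; simp

theorem sInf_nat {P : α → ℕ → Bool} (hP : ComputableIn O fun p : α × ℕ => P p.1 p.2)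
    (hex : ∀ a, ∃ n, P a n = true) : ComputableIn O fun a => sInf {n | P a n = true} := by
  -- Unbounded search looks for a zero, so `true` must become `0`.
  have h01 : ComputableIn O fun b : Bool => cond b 0 1 := (Primrec.dom_bool _).computableIn
  refine (Nat.RecursiveIn.rfind (h01.comp hP)).of_eq fun n => ?_
  rcases e : Encodable.decode (α := α) n with - | a
  · simpa [e] using Nat.rfind_zero_none _ rfl
  · simp only [Part.coe_some, Part.bind_some, Part.map_some]
    refine Part.eq_some_iff.2 (Nat.mem_rfind.2 ⟨?_, fun {m} hm => ?_⟩)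
    · have : P a (sInf {n | P a n = true}) = true := Nat.sInf_mem (s := {n | P a n = true}) (hex a)
      simp [e, this]
    · have : ¬ P a m = true := Nat.notMem_of_lt_sInf (s := {n | P a n = true}) hm
      simp [e, this]

theorem ball_lt {P : α → ℕ → Prop} [∀ a k, Decidable (P a k)] {b : α → ℕ}
    [∀ a, Decidable (∀ k < b a, P a k)]
    (hP : ComputableIn O fun p : α × ℕ => decide (P p.1 p.2)) (hb : ComputableIn O b) :
    ComputableIn O fun a => decide (∀ k < b a, P a k) := by
  have hand : ComputableIn O fun p : Bool × Bool => (p.1 && p.2) := Primrec.and.computableIn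
  have key := nat_rec (h := fun a k (c : Bool) => c && decide (P a k)) hb
    (ComputableIn.const (O := O) (α := α) true)
    (hand.comp ((ComputableIn.snd.comp ComputableIn.snd).pair
      (hP.comp (ComputableIn.fst.pair (ComputableIn.fst.comp ComputableIn.snd)))))
  convert key using 2 with a
  have aux (m : ℕ) : Nat.rec (motive := fun _ => Bool) true (fun y IH => IH && decide (P a y)) m
      = true ↔ ∀ k < m, P a k := by
    induction m with
    | zero => simp
    | succ m ih => simp [ih, Nat.forall_lt_succ_right, -Order.lt_add_one_iff]
  rw [Bool.eq_iff_iff, aux, decide_eq_true_iff]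

theorem eq_nat {f g : α → ℕ} (hf : ComputableIn O f) (hg : ComputableIn O g) :
    ComputableIn O fun a => decide (f a = g a) :=
  comp₂ (f := fun a b : ℕ => decide (a = b)) (PrimrecRel.decide Primrec.eq).computableIn hf hg

theorem lt_nat {f g : α → ℕ} (hf : ComputableIn O f) (hg : ComputableIn O g) :
    ComputableIn O fun a => decide (f a < g a) :=
  comp₂ (f := fun a b : ℕ => decide (a < b)) (PrimrecRel.decide Primrec.nat_lt).computableIn hf hg

theorem eq_bool {f g : α → Bool} (hf : ComputableIn O f) (hg : ComputableIn O g) :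
    ComputableIn O fun a => decide (f a = g a) :=
  comp₂ (f := fun a b : Bool => decide (a = b)) (PrimrecRel.decide Primrec.eq).computableIn hf hg

theorem and {f g : α → Bool} (hf : ComputableIn O f) (hg : ComputableIn O g) :
    ComputableIn O fun a => f a && g a :=
  comp₂ (f := fun a b : Bool => a && b) Primrec.and.computableIn hf hg

theorem not {f : α → Bool} (hf : ComputableIn O f) : ComputableIn O fun a => !f a :=
  comp Primrec.not.computableIn hf

theorem add {f g : α → ℕ} (hf : ComputableIn O f) (hg : ComputableIn O g) :
    ComputableIn O fun a => f a + g a :=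
  comp₂ (f := fun a b : ℕ => a + b) Primrec.nat_add.computableIn hf hg

end ComputableIn

namespace OneDimSubshift

open Equiv (intEquivNat)

/-! ### Translation in the enumeration of the integers. -/

section Enumeration

theorem intEquivNat_apply (z : ℤ) :
    intEquivNat z = if 0 ≤ z then 2 * z.toNat else 2 * (-z - 1).toNat + 1 := by
  cases z with
  | ofNat n =>
    rw [if_pos (by simp)]
    rfl
  | negSucc n =>
    rw [if_neg (by simp), show (-Int.negSucc n - 1).toNat = n by omega]
    rfl

theorem intEquivNat_symm_apply (k : ℕ) :
    intEquivNat.symm k = if k % 2 = 0 then ((k / 2 : ℕ) : ℤ) else -((k / 2 : ℕ) : ℤ) - 1 := by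
  rw [Equiv.symm_apply_eq, intEquivNat_apply]
  split_ifs <;> omega

theorem intEquivNat_natCast (m : ℕ) : intEquivNat (m : ℤ) = 2 * m := by
  simp [intEquivNat_apply]

theorem intEquivNat_add_le (n k : ℕ) :
    intEquivNat (n + intEquivNat.symm k) ≤ k + 2 * n := by
  rw [intEquivNat_apply, intEquivNat_symm_apply]
  split_ifs <;> omega

theorem primrec_intEquivNat_add :
    Primrec fun p : ℕ × ℕ => intEquivNat (p.1 + intEquivNat.symm p.2) := by
  have h2 : Primrec fun p : ℕ × ℕ => p.2 / 2 :=
    Primrec.nat_div.comp Primrec.snd (Primrec.const 2)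
  have hd (f : ℕ × ℕ → ℕ) (hf : Primrec f) : Primrec fun p => 2 * f p :=
    Primrec.nat_mul.comp (Primrec.const 2) hf
  refine (Primrec.ite (c := fun p : ℕ × ℕ => p.2 % 2 = 0)
    (Primrec.eq.comp (Primrec.nat_mod.comp Primrec.snd (Primrec.const 2)) (Primrec.const 0))
    (hd _ (Primrec.nat_add.comp Primrec.fst h2))
    -- An odd index stands for a negative integer; this test decides whether the translate is
    -- nonnegative.
    (Primrec.ite (c := fun p : ℕ × ℕ => p.2 / 2 < p.1) (Primrec.nat_lt.comp h2 Primrec.fst)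
      (hd _ (Primrec.nat_sub.comp (Primrec.nat_sub.comp Primrec.fst h2) (Primrec.const 1)))
      (Primrec.succ.comp (hd _ (Primrec.nat_sub.comp h2 Primrec.fst))))).of_eq fun p => ?_
  rw [intEquivNat_apply, intEquivNat_symm_apply]
  split_ifs <;> omega

end Enumeration

/-! ### Recurrence and aperiodicity to the right. -/

/-- Every finite window of `w` reappears arbitrarily far to the right. A window is given by the
first `L` integers in the enumeration `0, -1, 1, -2, 2, …`. -/
def RecurrentRight (w : ℤ → ℕ) : Prop :=
  ∀ (q : ℤ) (L : ℕ) (a : ℤ), ∃ c ≥ a, ∀ k < L, w (c + intEquivNat.symm k) =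
    w (q + intEquivNat.symm k)

/-- No right half of `w` is periodic. -/
def AperiodicRight (w : ℤ → ℕ) : Prop :=
  ∀ (p : ℤ) (n : ℕ), 0 < n → ∃ m : ℕ, w (p + n + m) ≠ w (p + m)

theorem RecurrentRight.translate {w : ℤ → ℕ} (h : RecurrentRight w) (t : ℤ) :
    RecurrentRight fun z => w (t + z) := by
  intro q L a
  obtain ⟨c, hc, hL⟩ := h (t + q) L (t + a)
  refine ⟨c - t, by omega, fun k hk => ?_⟩
  convert hL k hk using 2 <;> ring

theorem AperiodicRight.translate {w : ℤ → ℕ} (h : AperiodicRight w) (t : ℤ) :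
    AperiodicRight fun z => w (t + z) := by
  intro p n hn
  simpa only [add_assoc] using h (t + p) n hn

theorem IsQuasiperiodic.exists_occurrence {S : Type*} {x : ℤ → S} (hx : IsQuasiperiodic x)
    (q : ℤ) (P : Finset ℤ) (hP : 0 ∈ P) (a : ℤ) : ∃ c ≥ a, ∀ i ∈ P, x (c + i) = x (q + i) := by
  obtain ⟨N, hN⟩ := hx P (fun i => x (q + i)) ⟨q, fun i => rfl⟩
  obtain ⟨c, hc, hI⟩ := hN a
  exact ⟨c, by simpa using (hI 0 hP).1, fun i hi => hc ⟨i, hi⟩⟩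

theorem IsQuasiperiodic.recurrentRight {S : Type*} {x : ℤ → S} (hx : IsQuasiperiodic x)
    (ν : S → ℕ) : RecurrentRight fun z => ν (x z) := by
  intro q L a
  obtain ⟨c, hc, h⟩ := hx.exists_occurrence q
    (insert 0 ((Finset.range L).image intEquivNat.symm)) (by simp) a
  exact ⟨c, hc, fun k hk => congrArg ν <| h _ <| Finset.mem_insert_of_mem <|
    Finset.mem_image_of_mem _ <| Finset.mem_range.2 hk⟩

/-- A period of one right half would spread to the whole line: the letters at `z` and `z + n`
reappear together inside that half, where they must agree. -/
theorem IsStrictlyQuasiperiodic.aperiodicRight {S : Type*} {x : ℤ → S}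
    (hx : IsStrictlyQuasiperiodic x) (ν : S ↪ ℕ) : AperiodicRight fun z => ν (x z) := by
  intro p n hn
  by_contra! h
  refine hx.2 ⟨n, hn, funext fun z => ?_⟩
  obtain ⟨c, hc, hP⟩ := hx.1.exists_occurrence z {0, (n : ℤ)} (by simp) p
  have h0 := hP 0 (by simp)
  have h1 := hP n (by simp)
  have h2 := ν.injective (h (c - p).toNat)
  rw [show p + n + ((c - p).toNat : ℤ) = c + n by omega,
    show p + ((c - p).toNat : ℤ) = c + 0 by omega, h0, h1] at h2
  simpa [add_comm] using h2

/-! ### First returns, mismatches and the bit of a window. -/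

/-- The first positive return of the window formed by the first `R` integers. -/
noncomputable def returnTime (w : ℤ → ℕ) (R : ℕ) : ℕ :=
  sInf {n | 0 < n ∧ ∀ k < R, w (n + intEquivNat.symm k) = w (intEquivNat.symm k)}

/-- The first place where the right halves starting at `0` and at the return differ. -/
noncomputable def mismatch (w : ℤ → ℕ) (R : ℕ) : ℕ :=
  sInf {m | w (returnTime w R + m) ≠ w m}

/-- A window large enough to compute the return and the mismatch. -/
noncomputable def nextRadius (w : ℤ → ℕ) (R : ℕ) : ℕ :=
  R + 2 * returnTime w R + 2 * mismatch w R + 1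

/-- The bit recorded by `w` at the window of size `R`: the outcome of the lexicographic comparison
of the right halves starting at `0` and at the first return. -/
noncomputable def codedBit (w : ℤ → ℕ) (R : ℕ) : Bool :=
  decide (w (mismatch w R) < w (returnTime w R + mismatch w R))

section Return

variable {w w' : ℤ → ℕ} {R : ℕ}

theorem RecurrentRight.exists_return (h : RecurrentRight w) (R : ℕ) :
    ∃ n : ℕ, 0 < n ∧ ∀ k < R, w (n + intEquivNat.symm k) = w (intEquivNat.symm k) := by
  obtain ⟨c, hc, hL⟩ := h 0 R 1
  lift c to ℕ using by omega
  exact ⟨c, by omega, fun k hk => by simpa using hL k hk⟩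

theorem RecurrentRight.returnTime_spec (h : RecurrentRight w) (R : ℕ) :
    0 < returnTime w R ∧
      ∀ k < R, w (returnTime w R + intEquivNat.symm k) = w (intEquivNat.symm k) :=
  Nat.sInf_mem (s := {n | 0 < n ∧ ∀ k < R, w (n + intEquivNat.symm k) = w (intEquivNat.symm k)})
    (h.exists_return R)

theorem returnTime_le {n : ℕ} (hn : 0 < n)
    (h : ∀ k < R, w (n + intEquivNat.symm k) = w (intEquivNat.symm k)) : returnTime w R ≤ n :=
  Nat.sInf_le ⟨hn, h⟩

theorem AperiodicRight.exists_mismatch (h : AperiodicRight w) (hr : RecurrentRight w) (R : ℕ) :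
    ∃ m : ℕ, w (returnTime w R + m) ≠ w m := by
  simpa using h 0 _ (hr.returnTime_spec R).1

theorem AperiodicRight.mismatch_spec (h : AperiodicRight w) (hr : RecurrentRight w) (R : ℕ) :
    w (returnTime w R + mismatch w R) ≠ w (mismatch w R) :=
  Nat.sInf_mem (s := {m | w (returnTime w R + m) ≠ w m}) (h.exists_mismatch hr R)

theorem eq_of_lt_mismatch {m : ℕ} (h : m < mismatch w R) : w (returnTime w R + m) = w m := by
  simpa using Nat.notMem_of_lt_sInf (s := {m | w (returnTime w R + m) ≠ w m}) h

/-- Every test up to the first return stays inside the larger window. Nothing else is asked of `w'`,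
so this applies to the limit configuration. -/
theorem returnTime_congr (hr : RecurrentRight w)
    (h : ∀ k < nextRadius w R, w (intEquivNat.symm k) = w' (intEquivNat.symm k)) :
    returnTime w' R = returnTime w R := by
  have hz (z : ℤ) (hz : intEquivNat z < nextRadius w R) : w z = w' z := by
    simpa using h _ hz
  have hk (n k : ℕ) (hn : n ≤ returnTime w R) (hk : k < R) :
      (w (n + intEquivNat.symm k) = w (intEquivNat.symm k)) ↔
      (w' (n + intEquivNat.symm k) = w' (intEquivNat.symm k)) := by
    have := intEquivNat_add_le n k
    rw [hz _ (by unfold nextRadius; omega), h k (by unfold nextRadius; omega)]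
  have hs := hr.returnTime_spec R
  refine IsLeast.csInf_eq ⟨⟨hs.1, fun k hkR => (hk _ _ le_rfl hkR).1 (hs.2 k hkR)⟩, ?_⟩
  rintro n ⟨hn, hn'⟩
  by_contra! hlt
  exact hlt.not_ge (returnTime_le hn fun k hkR => (hk _ _ hlt.le hkR).2 (hn' k hkR))

theorem mismatch_congr (hr : RecurrentRight w) (ha : AperiodicRight w)
    (h : ∀ k < nextRadius w R, w (intEquivNat.symm k) = w' (intEquivNat.symm k)) :
    mismatch w' R = mismatch w R := by
  have hz (n : ℕ) (hn : n ≤ returnTime w R + mismatch w R) : w n = w' n := by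
    simpa using h (intEquivNat n) (by rw [intEquivNat_natCast]; unfold nextRadius; omega)
  have hm (m : ℕ) (hm : m ≤ mismatch w R) :
      w (returnTime w R + m) ≠ w m ↔ w' (returnTime w R + m) ≠ w' m := by
    rw [hz m (by omega), ← Nat.cast_add, hz _ (by omega)]
  rw [mismatch, returnTime_congr hr h]
  refine IsLeast.csInf_eq ⟨(hm _ le_rfl).1 (ha.mismatch_spec hr R), fun m hm' => ?_⟩
  by_contra! hlt
  exact (hm m hlt.le).2 hm' (eq_of_lt_mismatch hlt)

theorem nextRadius_congr (hr : RecurrentRight w) (ha : AperiodicRight w)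
    (h : ∀ k < nextRadius w R, w (intEquivNat.symm k) = w' (intEquivNat.symm k)) :
    nextRadius w' R = nextRadius w R := by
  rw [nextRadius, nextRadius, returnTime_congr hr h, mismatch_congr hr ha h]

theorem codedBit_congr (hr : RecurrentRight w) (ha : AperiodicRight w)
    (h : ∀ k < nextRadius w R, w (intEquivNat.symm k) = w' (intEquivNat.symm k)) :
    codedBit w' R = codedBit w R := by
  have hz (n : ℕ) (hn : n ≤ returnTime w R + mismatch w R) : w n = w' n := by
    simpa using h (intEquivNat n) (by rw [intEquivNat_natCast]; unfold nextRadius; omega)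
  rw [codedBit, codedBit, returnTime_congr hr h, mismatch_congr hr ha h, hz _ (by omega),
    ← Nat.cast_add, hz _ le_rfl]

end Return

/-! ### Both bits occur. -/

/-- Lexicographic comparison, by `r`, of the right halves of `w` starting at `a` and at `b`. -/
def LexAt (w : ℤ → ℕ) (r : ℕ → ℕ → Prop) (a b : ℤ) : Prop :=
  ∃ m : ℕ, (∀ i < m, w (a + i) = w (b + i)) ∧ r (w (a + m)) (w (b + m))

theorem LexAt.trans {w : ℤ → ℕ} {r : ℕ → ℕ → Prop} (hr : ∀ i j k, r i j → r j k → r i k)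
    {a b c : ℤ} (hab : LexAt w r a b) (hbc : LexAt w r b c) : LexAt w r a c := by
  obtain ⟨m, hm, hm'⟩ := hab
  obtain ⟨n, hn, hn'⟩ := hbc
  rcases lt_trichotomy m n with h | rfl | h
  · exact ⟨m, fun i hi => (hm i hi).trans (hn i (hi.trans h)), hn m h ▸ hm'⟩
  · exact ⟨m, fun i hi => (hm i hi).trans (hn i hi), hr _ _ _ hm' hn'⟩
  · exact ⟨n, fun i hi => (hm i (hi.trans h)).trans (hn i hi), (hm n h).symm ▸ hn'⟩

/-- If every occurrence of a window compares in the same way with the next one, then the right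
halves at the occurrences are monotone. -/
theorem lexAt_of_forall_return {w : ℤ → ℕ} {r : ℕ → ℕ → Prop}
    (htrans : ∀ i j k, r i j → r j k → r i k) (hw : RecurrentRight w) {u : ℕ → ℕ} {R : ℕ}
    (hret : ∀ c : ℤ, 0 ≤ c → (∀ k < R, w (c + intEquivNat.symm k) = u k) →
      LexAt w r c (c + returnTime (fun z => w (c + z)) R)) (n : ℕ) :
    ∀ a : ℤ, 0 ≤ a → 0 < n → (∀ k < R, w (a + intEquivNat.symm k) = u k) →
      (∀ k < R, w (a + n + intEquivNat.symm k) = u k) → LexAt w r a (a + n) := by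
  induction n using Nat.strong_induction_on with
  | _ n ih =>
    intro a h0 hn ha hb
    obtain ⟨hpos, hocc⟩ := (hw.translate a).returnTime_spec R
    have hle : returnTime (fun z => w (a + z)) R ≤ n :=
      returnTime_le hn fun k hk => by rw [ha k hk, ← add_assoc, hb k hk]
    have h1 := hret a h0 ha
    set t := returnTime (fun z => w (a + z)) R
    rcases hle.eq_or_lt with h | h
    · rwa [h] at h1
    · have hnt : a + t + ((n - t : ℕ) : ℤ) = a + n := by omega
      have h2 := ih (n - t) (by omega) (a + t) (by omega) (by omega)
        (fun k hk => by rw [add_assoc, hocc k hk, ha k hk]) (fun k hk => by rw [hnt, hb k hk])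
      rw [hnt] at h2
      exact h1.trans htrans h2

/-- Every window reappears recording any prescribed bit. -/
theorem exists_codedBit_eq {w : ℤ → ℕ} (hw : RecurrentRight w) (ha : AperiodicRight w)
    (q : ℤ) (R : ℕ) (b : Bool) :
    ∃ c : ℕ, (∀ k < R, w (c + intEquivNat.symm k) = w (q + intEquivNat.symm k)) ∧
      codedBit (fun z => w (c + z)) R = b := by
  by_contra! hne
  -- The strict order expressing that the recorded bit is the opposite of `b`.
  set r : ℕ → ℕ → Prop := fun i j => if b then j < i else i < j with hrdef
  have htrans : ∀ i j k, r i j → r j k → r i k := by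
    intro i j k; cases b <;> simp only [hrdef] <;> grind
  have hasymm : ∀ i j, r i j → ¬ r j i := by
    intro i j; cases b <;> simp only [hrdef] <;> grind
  have hret (c : ℤ) (h0 : 0 ≤ c)
      (hc : ∀ k < R, w (c + intEquivNat.symm k) = w (q + intEquivNat.symm k)) :
      LexAt w r c (c + returnTime (fun z => w (c + z)) R) := by
    lift c to ℕ using h0
    have hb := hne c hc
    have hs := (ha.translate c).mismatch_spec (hw.translate c) R
    refine ⟨mismatch (fun z => w (c + z)) R, fun i hi => ?_, ?_⟩
    · simpa only [add_assoc] using (eq_of_lt_mismatch hi).symm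
    · rw [add_assoc]
      unfold codedBit at hb
      cases b <;> simp_all; omega
  obtain ⟨c₀, h0, hc₀⟩ := hw q R 0
  obtain ⟨hpos, hocc⟩ := (hw.translate c₀).returnTime_spec R
  obtain ⟨M, hM, hM'⟩ := hret c₀ h0 hc₀
  set t := returnTime (fun z => w (c₀ + z)) R
  -- The size covers the original window and the positions `0, …, M`, whose indices are at most `2 *
  -- M`; the copy lies beyond the first return.
  obtain ⟨c, hc, hcL⟩ := hw c₀ (R + 2 * M + 1) (c₀ + t + 1)
  have hci (i : ℕ) (hi : i ≤ M) : w (c + i) = w (c₀ + i) := by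
    simpa using hcL (intEquivNat i) (by rw [intEquivNat_natCast]; omega)
  have hn : c₀ + t + ((c - (c₀ + t)).toNat : ℤ) = c := by omega
  have key := lexAt_of_forall_return htrans hw hret (c - (c₀ + t)).toNat (c₀ + t) (by omega)
    (by omega) (fun k hk => by rw [add_assoc, hocc k hk, hc₀ k hk])
    (fun k hk => by rw [hn, hcL k (by omega), hc₀ k hk])
  rw [hn] at key
  obtain ⟨m, hm, hm'⟩ := key
  -- The half at `c₀` precedes the one at `c₀ + t`, which precedes the one at `c`; yet `c` and `c₀`
  -- agree through `M`, where the first comparison is decided.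
  rcases lt_trichotomy m M with h | rfl | h
  · rw [← hM m h, hci m h.le] at hm'
    exact hasymm _ _ hm' hm'
  · rw [hci m le_rfl] at hm'
    exact hasymm _ _ hm' hM'
  · rw [hm M h, hci M le_rfl] at hM'
    exact hasymm _ _ hM' hM'

/-! ### Computing returns and bits uniformly in a family of configurations. -/

section Computability

variable {α : Type*} [Primcodable α] {O : Set (ℕ →. ℕ)}

theorem computableIn_translate {f : ℤ → ℕ} (hf : ComputableIn O fun k => f (intEquivNat.symm k)) :
    ComputableIn O fun p : ℕ × ℕ => f (p.1 + intEquivNat.symm p.2) := by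
  simpa using hf.comp primrec_intEquivNat_add.computableIn

variable {W : α → ℤ → ℕ}

theorem computableIn_family_translate
    (hW : ComputableIn O fun p : α × ℕ => W p.1 (intEquivNat.symm p.2)) :
    ComputableIn O fun p : α × ℕ × ℕ => W p.1 (p.2.1 + intEquivNat.symm p.2.2) := by
  simpa using hW.comp
    (ComputableIn.fst.pair (primrec_intEquivNat_add.computableIn.comp ComputableIn.snd))

theorem computableIn_family_natCast
    (hW : ComputableIn O fun p : α × ℕ => W p.1 (intEquivNat.symm p.2)) :
    ComputableIn O fun p : α × ℕ => W p.1 p.2 := by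
  simpa [← intEquivNat_natCast] using hW.comp (ComputableIn.fst.pair
    ((Primrec.nat_mul.comp (Primrec.const 2) Primrec.id).computableIn.comp ComputableIn.snd))

variable (hW : ComputableIn O fun p : α × ℕ => W p.1 (intEquivNat.symm p.2))
  (hr : ∀ a, RecurrentRight (W a)) (ha : ∀ a, AperiodicRight (W a))
include hW hr

theorem computableIn_returnTime :
    ComputableIn O fun p : α × ℕ => returnTime (W p.1) p.2 := by
  classical
  have h1 := (computableIn_family_translate hW).comp
    ((ComputableIn.fst.comp (ComputableIn.fst.comp ComputableIn.fst)).pair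
      ((ComputableIn.snd.comp ComputableIn.fst).pair ComputableIn.snd) :
      ComputableIn O fun q : ((α × ℕ) × ℕ) × ℕ => (q.1.1.1, q.1.2, q.2))
  have h2 := hW.comp ((ComputableIn.fst.comp (ComputableIn.fst.comp ComputableIn.fst)).pair
    ComputableIn.snd : ComputableIn O fun q : ((α × ℕ) × ℕ) × ℕ => (q.1.1.1, q.2))
  have hball := ComputableIn.ball_lt
    (P := fun (q : (α × ℕ) × ℕ) k =>
      W q.1.1 (q.2 + intEquivNat.symm k) = W q.1.1 (intEquivNat.symm k))
    (b := fun q : (α × ℕ) × ℕ => q.1.2) (h1.eq_nat h2)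
    (ComputableIn.snd.comp ComputableIn.fst)
  have h3 := ComputableIn.sInf_nat
    (P := fun (p : α × ℕ) n => decide (0 < n) && decide (∀ k < p.2,
      W p.1 (n + intEquivNat.symm k) = W p.1 (intEquivNat.symm k)))
    (((ComputableIn.const 0).lt_nat ComputableIn.snd).and hball)
    (fun p => by simpa using (hr p.1).exists_return p.2)
  simpa [returnTime] using h3

include ha

theorem computableIn_mismatch :
    ComputableIn O fun p : α × ℕ => mismatch (W p.1) p.2 := by
  have hv := computableIn_family_natCast hW
  have h := ComputableIn.sInf_nat
    (P := fun (p : α × ℕ) m => !decide (W p.1 (returnTime (W p.1) p.2 + m : ℕ) = W p.1 m))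
    (((hv.comp ((ComputableIn.fst.comp ComputableIn.fst).pair
      (((computableIn_returnTime hW hr).comp ComputableIn.fst).add ComputableIn.snd))).eq_nat
      (hv.comp ((ComputableIn.fst.comp ComputableIn.fst).pair ComputableIn.snd))).not)
    (fun p => by simpa using (ha p.1).exists_mismatch (hr p.1) p.2)
  simpa [mismatch] using h

theorem computableIn_nextRadius :
    ComputableIn O fun p : α × ℕ => nextRadius (W p.1) p.2 := by
  have h2 (f : α × ℕ → ℕ) (hf : ComputableIn O f) : ComputableIn O fun p => 2 * f p := by
    simpa [two_mul] using hf.add hf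
  exact ((ComputableIn.snd.add (h2 _ (computableIn_returnTime hW hr))).add
    (h2 _ (computableIn_mismatch hW hr ha))).add (ComputableIn.const 1)

theorem computableIn_codedBit :
    ComputableIn O fun p : α × ℕ => codedBit (W p.1) p.2 := by
  have hv := computableIn_family_natCast hW
  have hm := computableIn_mismatch hW hr ha
  simpa [codedBit] using (hv.comp (ComputableIn.fst.pair hm)).lt_nat
    (hv.comp (ComputableIn.fst.pair ((computableIn_returnTime hW hr).add hm)))

end Computability

/-! ### Recording a sequence by successive recentering. -/

/-- The first position of `f` where the window of size `R` at `q` reappears recording `b`. -/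
noncomputable def nextPos (f : ℤ → ℕ) (q R : ℕ) (b : Bool) : ℕ :=
  sInf {p | (∀ k < R, f (p + intEquivNat.symm k) = f (q + intEquivNat.symm k)) ∧
    codedBit (fun z => f (p + z)) R = b}

/-- The position and size of the window of `f` reached after recording the first bits of `s`. -/
noncomputable def codeState (f : ℤ → ℕ) (s : ℕ → Bool) (i : ℕ) : ℕ × ℕ :=
  Nat.rec (motive := fun _ => ℕ × ℕ) (0, 0) (fun i st =>
    (nextPos f st.1 st.2 (s i),
      nextRadius (fun z => f (nextPos f st.1 st.2 (s i) + z)) st.2)) i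

/-- The configuration obtained from `x` by recentering at the positions that record `s`. -/
noncomputable def codedConfig {S : Type*} (ν : S → ℕ) (x : ℤ → S) (s : ℕ → Bool) (z : ℤ) : S :=
  x ((codeState (fun z => ν (x z)) s (intEquivNat z + 1)).1 + z)

section Coding

variable {f : ℤ → ℕ} (hr : RecurrentRight f) (ha : AperiodicRight f)
include hr ha

theorem nextPos_spec (q R : ℕ) (b : Bool) :
    (∀ k < R, f (nextPos f q R b + intEquivNat.symm k) = f (q + intEquivNat.symm k)) ∧
      codedBit (fun z => f (nextPos f q R b + z)) R = b :=
  Nat.sInf_mem (s := {p : ℕ | (∀ k < R, f (p + intEquivNat.symm k) = f (q + intEquivNat.symm k)) ∧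
    codedBit (fun z => f (p + z)) R = b}) (exists_codedBit_eq hr ha q R b)

theorem computableIn_nextPos {O : Set (ℕ →. ℕ)}
    (hf : ComputableIn O fun k => f (intEquivNat.symm k)) :
    ComputableIn O fun p : (ℕ × ℕ) × Bool => nextPos f p.1.1 p.1.2 p.2 := by
  classical
  have ht := computableIn_translate hf
  have hcb : ComputableIn O fun p : ℕ × ℕ => codedBit (fun z => f (p.1 + z)) p.2 :=
    computableIn_codedBit (W := fun (q : ℕ) z => f (q + z)) ht (fun q => hr.translate q)
      (fun q => ha.translate q)
  have h1 := ht.comp ((ComputableIn.snd.comp ComputableIn.fst).pair ComputableIn.snd :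
    ComputableIn O fun q : (((ℕ × ℕ) × Bool) × ℕ) × ℕ => (q.1.2, q.2))
  have h2 := ht.comp ((ComputableIn.fst.comp (ComputableIn.fst.comp
    (ComputableIn.fst.comp ComputableIn.fst))).pair ComputableIn.snd :
    ComputableIn O fun q : (((ℕ × ℕ) × Bool) × ℕ) × ℕ => (q.1.1.1.1, q.2))
  have hball := ComputableIn.ball_lt
    (P := fun (q : ((ℕ × ℕ) × Bool) × ℕ) k =>
      f (q.2 + intEquivNat.symm k) = f (q.1.1.1 + intEquivNat.symm k))
    (b := fun q : ((ℕ × ℕ) × Bool) × ℕ => q.1.1.2) (h1.eq_nat h2)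
    (ComputableIn.snd.comp (ComputableIn.fst.comp ComputableIn.fst))
  have h3 := hcb.comp (ComputableIn.snd.pair
    (ComputableIn.snd.comp (ComputableIn.fst.comp ComputableIn.fst)) :
    ComputableIn O fun q : ((ℕ × ℕ) × Bool) × ℕ => (q.2, q.1.1.2))
  have h4 := ComputableIn.sInf_nat
    (P := fun (p : (ℕ × ℕ) × Bool) n => decide (∀ k < p.1.2,
      f (n + intEquivNat.symm k) = f (p.1.1 + intEquivNat.symm k)) &&
        decide (codedBit (fun z => f (n + z)) p.1.2 = p.2))
    (hball.and (h3.eq_bool (ComputableIn.snd.comp ComputableIn.fst)))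
    (fun p => by simpa using exists_codedBit_eq hr ha p.1.1 p.1.2 p.2)
  simpa [nextPos] using h4

theorem computableIn_codeState {O : Set (ℕ →. ℕ)} {s : ℕ → Bool}
    (hf : ComputableIn O fun k => f (intEquivNat.symm k)) (hs : ComputableIn O s) :
    ComputableIn O (codeState f s) := by
  have hnp := (computableIn_nextPos hr ha hf).comp
    ((ComputableIn.snd.comp ComputableIn.snd).pair
      (hs.comp (ComputableIn.fst.comp ComputableIn.snd)) :
      ComputableIn O fun p : ℕ × ℕ × (ℕ × ℕ) => (p.2.2, s p.2.1))
  have hnr := computableIn_nextRadius (W := fun (q : ℕ) z => f (q + z)) (computableIn_translate hf)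
    (fun q => hr.translate q) (fun q => ha.translate q)
  have hnr' := hnr.comp (hnp.pair
    (ComputableIn.snd.comp (ComputableIn.snd.comp ComputableIn.snd)))
  exact ComputableIn.nat_rec (h := fun _ i (st : ℕ × ℕ) => (nextPos f st.1 st.2 (s i),
      nextRadius (fun z => f (nextPos f st.1 st.2 (s i) + z)) st.2))
    ComputableIn.id (ComputableIn.const (0, 0)) (hnp.pair hnr')

variable (s : ℕ → Bool)

omit hr ha in
theorem codeState_snd_succ (i : ℕ) : (codeState f s (i + 1)).2 =
    nextRadius (fun z => f ((codeState f s (i + 1)).1 + z)) (codeState f s i).2 := rfl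

omit hr ha in
theorem codeState_snd_strictMono : StrictMono fun i => (codeState f s i).2 := by
  refine strictMono_nat_of_lt_succ fun i => ?_
  rw [codeState_snd_succ]
  unfold nextRadius
  omega

/-- Each move preserves the current window, which contains all earlier ones. -/
theorem codeState_coherent {i j : ℕ} (hij : i ≤ j) {k : ℕ} (hk : k < (codeState f s i).2) :
    f ((codeState f s j).1 + intEquivNat.symm k) =
      f ((codeState f s i).1 + intEquivNat.symm k) := by
  induction j, hij using Nat.le_induction with
  | base => rfl
  | succ j hij ih =>
    rw [← ih]
    exact (nextPos_spec hr ha _ _ (s j)).1 k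
      (hk.trans_le ((codeState_snd_strictMono (f := f) s).monotone hij))

end Coding

/-! ### The limit configuration and its decoding. -/

section Config

variable {S : Type*} {ν : S → ℕ} {x : ℤ → S} (hr : RecurrentRight fun z => ν (x z))
  (ha : AperiodicRight fun z => ν (x z)) (s : ℕ → Bool)
include hr ha

theorem codedConfig_eq {i k : ℕ} (hk : k < (codeState (fun z => ν (x z)) s i).2) :
    ν (codedConfig ν x s (intEquivNat.symm k)) =
      ν (x ((codeState (fun z => ν (x z)) s i).1 + intEquivNat.symm k)) := by
  -- Radii start at `0` and strictly increase, so stage `k + 1` already covers index `k`; hence the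
  -- `+ 1` in `codedConfig`.
  have hk' : k < (codeState (fun z => ν (x z)) s (k + 1)).2 :=
    (codeState_snd_strictMono s).le_apply (x := k + 1)
  rw [codedConfig, Equiv.apply_symm_apply]
  rcases le_total i (k + 1) with h | h
  · exact codeState_coherent hr ha s h hk
  · exact (codeState_coherent hr ha s h hk').symm

theorem nextRadius_codedConfig (i : ℕ) :
    nextRadius (fun z => ν (codedConfig ν x s z)) (codeState (fun z => ν (x z)) s i).2 =
      (codeState (fun z => ν (x z)) s (i + 1)).2 :=
  nextRadius_congr (hr.translate (codeState (fun z => ν (x z)) s (i + 1)).1) (ha.translate _)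
    fun _ hk => (codedConfig_eq hr ha s (i := i + 1) hk).symm

theorem codedBit_codedConfig (i : ℕ) :
    codedBit (fun z => ν (codedConfig ν x s z)) (codeState (fun z => ν (x z)) s i).2 = s i :=
  (codedBit_congr (hr.translate (codeState (fun z => ν (x z)) s (i + 1)).1) (ha.translate _)
    fun _ hk => (codedConfig_eq hr ha s (i := i + 1) hk).symm).trans
    (nextPos_spec hr ha _ _ (s i)).2

theorem computableIn_codedConfig {O : Set (ℕ →. ℕ)}
    (hx : ComputableIn O fun k => ν (x (intEquivNat.symm k))) (hs : ComputableIn O s) :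
    ComputableIn O fun k => ν (codedConfig ν x s (intEquivNat.symm k)) := by
  simpa [codedConfig] using (computableIn_translate (f := fun z => ν (x z)) hx).comp
    ((ComputableIn.fst.comp ((computableIn_codeState hr ha hx hs).comp
      ComputableIn.succ)).pair ComputableIn.id)

theorem computableIn_of_codedConfig {O : Set (ℕ →. ℕ)}
    (hr' : RecurrentRight fun z => ν (codedConfig ν x s z))
    (ha' : AperiodicRight fun z => ν (codedConfig ν x s z))
    (hy : ComputableIn O fun k => ν (codedConfig ν x s (intEquivNat.symm k))) :
    ComputableIn O s := by
  have hW : ComputableIn O fun p : ℕ × ℕ => ν (codedConfig ν x s (intEquivNat.symm p.2)) :=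
    hy.comp ComputableIn.snd
  -- The radii are recovered by iterating `nextRadius` on the limit configuration from `0`, with no
  -- access to `x` or `s`.
  have hrad : ComputableIn O fun i => (codeState (fun z => ν (x z)) s i).2 := by
    have hnr := computableIn_nextRadius (W := fun (_ : ℕ) z => ν (codedConfig ν x s z)) hW
      (fun _ => hr') (fun _ => ha')
    have hnr' := hnr.comp (ComputableIn.fst.pair (ComputableIn.snd.comp ComputableIn.snd) :
      ComputableIn O fun p : ℕ × ℕ × ℕ => (p.1, p.2.2))
    have := ComputableIn.nat_rec
      (h := fun (_ : ℕ) (_ : ℕ) R => nextRadius (fun z => ν (codedConfig ν x s z)) R)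
      (ComputableIn.id (O := O)) (ComputableIn.const 0) hnr'
    convert this with i
    induction i with
    | zero => rfl
    | succ i ih => rw [← nextRadius_codedConfig hr ha, ih]; rfl
  simpa only [codedBit_codedConfig hr ha] using
    (computableIn_codedBit (W := fun (_ : ℕ) z => ν (codedConfig ν x s z)) hW
      (fun _ => hr') (fun _ => ha')).comp (ComputableIn.id.pair hrad)

end Config

/-- Coordinatewise, the shifts of `x` to the successive positions are eventually constant with value
the coded configuration, so closedness applies. -/
theorem codedConfig_mem {S : Type*} [TopologicalSpace S] [DiscreteTopology S] (ν : S ↪ ℕ)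
    (A : Subshift S ℤ) {x : ℤ → S} (hx : x ∈ A.carrier)
    (hr : RecurrentRight fun z => ν (x z)) (ha : AperiodicRight fun z => ν (x z))
    (s : ℕ → Bool) : codedConfig ν x s ∈ A.carrier := by
  refine A.isClosed.mem_of_tendsto (b := Filter.atTop)
    (f := fun i : ℕ => shift ((codeState (fun z => ν (x z)) s i).1 : ℤ) x) ?_
    (Filter.Eventually.of_forall fun i => A.mapsTo _ hx)
  refine tendsto_pi_nhds.2 fun z => tendsto_nhds_of_eventually_eq ?_
  filter_upwards [Filter.eventually_ge_atTop (intEquivNat z + 1)] with i hi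
  have hlt : intEquivNat z < (codeState (fun z => ν (x z)) s i).2 :=
    hi.trans ((codeState_snd_strictMono s).le_apply (x := i))
  have h := codedConfig_eq hr ha s hlt
  rw [Equiv.symm_apply_apply] at h
  exact (ν.injective h).symm

theorem degree_le_iff (f g : ℕ → ℕ) :
    degree f ≤ degree g ↔ ComputableIn {fun n => Part.some (g n)} f := Iff.rfl

theorem computableIn_toNat_iff {O : Set (ℕ →. ℕ)} (s : ℕ → Bool) :
    ComputableIn O (fun n => (s n).toNat) ↔ ComputableIn O s := by
  refine ⟨fun h => ?_, fun h => (Primrec.dom_bool Bool.toNat).computableIn.comp h⟩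
  simpa using h.eq_nat (ComputableIn.const 1)

end OneDimSubshift

theorem mainTheorem6 {S : Type*} [Finite S] [TopologicalSpace S] [DiscreteTopology S]
    (ν : S ↪ ℕ) (A : SymbolicDynamics.FullShift.Subshift S ℤ)
    (hmin : OneDimSubshift.IsMinimalSubshift A)
    (hsq : ∀ z ∈ A.carrier, OneDimSubshift.IsStrictlyQuasiperiodic z)
    (x : ℤ → S) (hx : x ∈ A.carrier)
    (d : TuringDegree) (hd : OneDimSubshift.IsClassicalDegree d)
    (hxd : OneDimSubshift.configDegree ν x ≤ d) :
    ∃ y ∈ A.carrier, OneDimSubshift.configDegree ν y = d := by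
  open OneDimSubshift in
  obtain ⟨s, rfl⟩ := hd
  have hr := (hsq x hx).1.recurrentRight ν
  have ha := (hsq x hx).aperiodicRight ν
  have hy := codedConfig_mem ν A hx hr ha s
  refine ⟨codedConfig ν x s, hy, le_antisymm ?_ ?_⟩
  · exact (degree_le_iff _ _).2 <| computableIn_codedConfig hr ha s ((degree_le_iff _ _).1 hxd) <|
      (computableIn_toNat_iff s).1 <| (degree_le_iff _ _).1 le_rfl
  -- The coded configuration lies in `A`, so it is itself strictly quasiperiodic and the decoding
  -- searches terminate.
  · exact (degree_le_iff _ _).2 <| (computableIn_toNat_iff s).2 <|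
      computableIn_of_codedConfig hr ha s ((hsq _ hy).1.recurrentRight ν)
        ((hsq _ hy).aperiodicRight ν) <| (degree_le_iff _ _).1 le_rfl
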